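/- Let $d\ge 1$. For a measurable $f:\mathbb R^d\to\mathbb C$ let $M(f)(x)=\sup_{r>0}\frac1{|B(x,r)|}\int_{B(x,r)}|f(y)|\,dy\in[0,\infty]$ be the (centred) Hardy--Littlewood maximal function, where $B(x,r)$ is the open ball with centre $x$ and radius $r$. For each $x\in\mathbb R^d$ let $\psi_x:[0,\infty)\to\mathbb R$ be locally integrable on $[0,\infty)$, and put $\Psi(x,t)=\Psi_x(t)=\int_0^t\psi_x(s)\,ds$ for $t\ge0$; assume that $x\mapsto\Psi(x,t)$ is measurable for every $t\ge0$. Suppose that 1. for every $x\in\mathbb R^d$, $\Psi_x(0)=0$, $\Psi_x$ is increasing (not necessarily strictly) on $[0,\infty)$, $\Psi_x(t)>0$ for all $t>0$, and $\Psi_x(t)\to\infty$ as $t\to\infty$; moreover there is a constant $C_0>0$ such that $\Psi_x(2t)\le C_0\Psi_x(t)$ for all $x\in\mathbb R^d$ and all $t\ge0$; 2. for every compact set $K\subset\mathbb R^d$ there is a constant $C_K>0$ such that $\Psi(x,t)\le C_K\Psi(y,t)$ for all $x,y\in K$ and all $t>0$; 3. for every $x\in\mathbb R^d$ and all $0<\alpha_0<\beta_0$,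 the function $s\mapsto\psi_x(s)/s$ is integrable on $[\alpha_0,\beta_0]$, that is, $\int_{\alpha_0}^{\beta_0}\frac{\psi_x(s)}{s}\,ds<\infty$. Let $B\subset\mathbb R^d$ be a closed ball of positive (finite) radius and let $f:\mathbb R^d\to\mathbb C$ be a measurable function with $\operatorname{supp}(f)\subseteq B$. Then $M(f)\in L_\Psi(B)$, meaning that $M(f)$ is measurable on $B$ and $$\int_B\Psi\bigl(x,M(f)(x)\bigr)\,dx<\infty\qquad(\text{with }\Psi(x,\infty)=\infty),$$ if and only if $$\int_{\{|f|>\alpha_0\}}|f(x)|\left(\int_{\alpha_0}^{|f(x)|}\frac{\psi_x(s)}{s}\,ds\right)dx<\infty\qquad\text{for every }\alpha_0>0.$$ -/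

import Mathlib

open MeasureTheory
open scoped ENNReal

noncomputable section

/-- The centred Hardy-Littlewood maximal function (open balls, Lebesgue averages of `|f|`),
with values in `[0, ∞]`. -/
def hardyLittlewood {d : ℕ} (f : EuclideanSpace ℝ (Fin d) → ℂ)
    (x : EuclideanSpace ℝ (Fin d)) : ℝ≥0∞ :=
  ⨆ (r : ℝ) (_ : 0 < r),
    (volume (Metric.ball x r))⁻¹ * ∫⁻ y in Metric.ball x r, ‖f y‖ₑ

/-- `Ψ(x,t) = ∫_0^t ψ_x(s) ds`. -/
def primitiveFn {d : ℕ} (ψ : EuclideanSpace ℝ (Fin d) → ℝ → ℝ)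
    (x : EuclideanSpace ℝ (Fin d)) (t : ℝ) : ℝ :=
  ∫ s in (0 : ℝ)..t, ψ x s

/-- `Ψ` is a uniformly doubling Orlicz function: each `Ψ_x` vanishes at `0`, is increasing on
`[0, ∞)`, positive on `(0, ∞)`, tends to `∞` at `∞`, and `Ψ_x(2t) ≤ C₀ Ψ_x(t)` with a constant
independent of `x` and `t`. -/
structure IsUniformlyDoublingOrlicz {d : ℕ} (Ψ : EuclideanSpace ℝ (Fin d) → ℝ → ℝ) : Prop where
  zero : ∀ x, Ψ x 0 = 0
  monotoneOn : ∀ x, MonotoneOn (Ψ x) (Set.Ici 0)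
  pos : ∀ x t, 0 < t → 0 < Ψ x t
  tendsto_atTop : ∀ x, Filter.Tendsto (Ψ x) Filter.atTop Filter.atTop
  doubling : ∃ C₀ : ℝ, 0 < C₀ ∧ ∀ x t, 0 ≤ t → Ψ x (2 * t) ≤ C₀ * Ψ x t

/-- Local comparability in `x`: on every compact set `K` the functions `Ψ_x`, `x ∈ K`, are
comparable with each other, with a constant depending only on `K`. -/
def IsLocallyComparable {d : ℕ} (Ψ : EuclideanSpace ℝ (Fin d) → ℝ → ℝ) : Prop :=
  ∀ K : Set (EuclideanSpace ℝ (Fin d)), IsCompact K →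
    ∃ C : ℝ, 0 < C ∧ ∀ x ∈ K, ∀ y ∈ K, ∀ t : ℝ, 0 < t → Ψ x t ≤ C * Ψ y t

/-- `Ψ(x,τ)` for `τ ∈ [0, ∞]`, with the limiting value `Ψ(x,∞) = ∞`. -/
def orliczExtend {d : ℕ} (Ψ : EuclideanSpace ℝ (Fin d) → ℝ → ℝ)
    (x : EuclideanSpace ℝ (Fin d)) (τ : ℝ≥0∞) : ℝ≥0∞ :=
  if τ = ∞ then ∞ else ENNReal.ofReal (Ψ x τ.toReal)

/-- Membership in `L_Ψ(B)` of a function with values in `[0, ∞]`: it is measurable on `B` and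
`∫_B Ψ(x, g(x)) dx < ∞`. -/
def MemMusielakOrlicz {d : ℕ} (Ψ : EuclideanSpace ℝ (Fin d) → ℝ → ℝ)
    (B : Set (EuclideanSpace ℝ (Fin d))) (g : EuclideanSpace ℝ (Fin d) → ℝ≥0∞) : Prop :=
  AEMeasurable g (volume.restrict B) ∧ ∫⁻ x in B, orliczExtend Ψ x (g x) < ∞

end

/-- Scaling of the volume of closed balls, for arbitrary centres. -/
theorem volume_closedBall_scale {d : ℕ} (x y : EuclideanSpace ℝ (Fin d)) {c ρ : ℝ}
    (hc : 0 ≤ c) (hρ : 0 ≤ ρ) :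
    volume (Metric.closedBall x (c * ρ)) =
      ENNReal.ofReal (c ^ d) * volume (Metric.closedBall y ρ) := by
  rw [Measure.addHaar_closedBall_mul volume x hc hρ, finrank_euclideanSpace_fin,
    Measure.addHaar_closedBall_center volume y ρ]

/-- The maximal function is Borel measurable (it is lower semicontinuous). -/
theorem measurable_hardyLittlewood {d : ℕ} (f : EuclideanSpace ℝ (Fin d) → ℂ) :
    Measurable (hardyLittlewood f) := by
  refine measurable_of_Ioi fun t => IsOpen.measurableSet ?_
  rw [Metric.isOpen_iff]
  intro x hx
  simp only [Set.mem_preimage, Set.mem_Ioi, hardyLittlewood, lt_iSup_iff] at hx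
  obtain ⟨r, hr, hx⟩ := hx
  have hun : Metric.ball x r = ⋃ n : ℕ, Metric.ball x (r - 1 / ((n : ℝ) + 1)) := by
    ext y
    simp only [Set.mem_iUnion, Metric.mem_ball]
    constructor
    · intro h
      obtain ⟨n, hn⟩ := exists_nat_one_div_lt (sub_pos.2 h)
      exact ⟨n, by linarith⟩
    · rintro ⟨n, hn⟩
      have : 0 < 1 / ((n : ℝ) + 1) := by positivity
      linarith
  have hdir : Directed (· ⊆ ·) fun n : ℕ => Metric.ball x (r - 1 / ((n : ℝ) + 1)) := by
    refine Monotone.directed_le fun m n hmn => Metric.ball_subset_ball ?_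
    have := one_div_le_one_div_of_le (by positivity : (0 : ℝ) < m + 1)
      (by exact_mod_cast Nat.succ_le_succ hmn : (m : ℝ) + 1 ≤ n + 1)
    linarith
  have hint : ∫⁻ y in Metric.ball x r, ‖f y‖ₑ =
      ⨆ n : ℕ, ∫⁻ y in Metric.ball x (r - 1 / ((n : ℝ) + 1)), ‖f y‖ₑ := by
    rw [hun]; exact setLIntegral_iUnion_of_directed _ hdir
  rw [hint, ENNReal.mul_iSup, lt_iSup_iff] at hx
  obtain ⟨n, hn⟩ := hx
  refine ⟨1 / ((n : ℝ) + 1), by positivity, fun y hy => ?_⟩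
  simp only [Set.mem_preimage, Set.mem_Ioi, hardyLittlewood, lt_iSup_iff]
  refine ⟨r, hr, hn.trans_le ?_⟩
  have hv : volume (Metric.ball x r) = volume (Metric.ball y r) := by
    rw [Measure.addHaar_ball_center volume x, Measure.addHaar_ball_center volume y]
  rw [hv]
  gcongr
  intro z hz
  rw [Metric.mem_ball] at hz hy ⊢
  rw [dist_comm] at hy
  linarith [dist_triangle z x y]

/-- Vitali's covering lemma for a family of closed balls with positive bounded radii. -/
theorem exists_countable_disjoint_closedBall_cover {d : ℕ} (A : Set (EuclideanSpace ℝ (Fin d)))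
    (ρ : EuclideanSpace ℝ (Fin d) → ℝ) (R : ℝ) (hpos : ∀ x ∈ A, 0 < ρ x)
    (hR : ∀ x ∈ A, ρ x ≤ R) :
    ∃ u ⊆ A, u.Countable ∧ (u.PairwiseDisjoint fun x => Metric.closedBall x (ρ x)) ∧
      A ⊆ ⋃ x ∈ u, Metric.closedBall x (5 * ρ x) := by
  obtain ⟨u, huA, hdis, hcov⟩ := Vitali.exists_disjoint_subfamily_covering_enlargement_closedBall
    A (fun x => x) ρ R hR 5 (by norm_num)
  refine ⟨u, huA, hdis.countable_of_nonempty_interior fun x hx => ?_, hdis, fun x hx => ?_⟩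
  · exact ⟨x, Metric.ball_subset_interior_closedBall
      (Metric.mem_ball_self (hpos x (huA hx)))⟩
  · obtain ⟨y, hy, hxy⟩ := hcov x hx
    exact Set.mem_biUnion hy (hxy (Metric.mem_closedBall_self (hpos x hx).le))

/-- A countable cover by balls estimates the measure of a set on which averages are large. -/
theorem mul_volume_le_lintegral_of_averages {d : ℕ} (hd : 0 < d)
    {g : EuclideanSpace ℝ (Fin d) → ℝ≥0∞}
    (hg : ∫⁻ x, g x ≠ ∞) {t : ℝ≥0∞} (ht : t ≠ 0) {A : Set (EuclideanSpace ℝ (Fin d))}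
    (hA : ∀ x ∈ A, ∃ ρ : ℝ, 0 < ρ ∧
      t * volume (Metric.closedBall x ρ) ≤ ∫⁻ y in Metric.closedBall x ρ, g y) :
    t * volume A ≤ 5 ^ d * ∫⁻ x, g x := by
  choose! ρ hρ hρA using hA
  obtain ⟨R, hR⟩ : ∃ R : ℝ, ∀ x ∈ A, ρ x ≤ R := by
    set v := volume (Metric.closedBall (0 : EuclideanSpace ℝ (Fin d)) 1) with hv
    have hv0 : v ≠ 0 := (Metric.measure_closedBall_pos volume _ one_pos).ne'
    set q := (∫⁻ x, g x) / (t * v) with hq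
    have hqt : q ≠ ∞ := ENNReal.div_ne_top hg (mul_ne_zero ht hv0)
    refine ⟨max 1 q.toReal, fun x hx => ?_⟩
    by_contra! hlt
    obtain ⟨h1, h2⟩ := max_lt_iff.1 hlt
    have h3 : t * (ENNReal.ofReal (ρ x ^ d) * v) ≤ ∫⁻ x, g x := by
      rw [hv, ← volume_closedBall_scale x 0 (hρ x hx).le zero_le_one, mul_one]
      exact (hρA x hx).trans (setLIntegral_le_lintegral _ _)
    have h4 : ENNReal.ofReal (ρ x ^ d) ≤ q := by
      rcases eq_or_ne (t * v) ∞ with h | h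
      · exfalso
        rw [mul_left_comm, h, ENNReal.mul_top] at h3
        · exact hg (top_le_iff.1 h3)
        · simpa using pow_pos (hρ x hx) d
      · rw [hq, ENNReal.le_div_iff_mul_le (Or.inl (mul_ne_zero ht hv0)) (Or.inl h)]
        calc _ = t * (ENNReal.ofReal (ρ x ^ d) * v) := by ring
          _ ≤ _ := h3
    have h5 : ρ x ≤ ρ x ^ d := le_self_pow₀ h1.le hd.ne'
    have h6 := ENNReal.toReal_mono hqt h4
    rw [ENNReal.toReal_ofReal (by have := hρ x hx; positivity)] at h6
    linarith
  obtain ⟨u, huA, huc, hdis, hcov⟩ := exists_countable_disjoint_closedBall_cover A ρ R hρ hR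
  calc t * volume A ≤ t * ∑' x : u, volume (Metric.closedBall (x : EuclideanSpace ℝ (Fin d))
        (5 * ρ x)) := by
        gcongr
        exact (measure_mono hcov).trans (measure_biUnion_le volume huc _)
    _ = 5 ^ d * ∑' x : u, t * volume (Metric.closedBall (x : EuclideanSpace ℝ (Fin d)) (ρ x)) := by
        rw [← ENNReal.tsum_mul_left, ← ENNReal.tsum_mul_left]
        refine tsum_congr fun x => ?_
        rw [volume_closedBall_scale x.1 x.1 (by norm_num) (hρ x (huA x.2)).le,
          ENNReal.ofReal_pow (by norm_num)]
        norm_num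
        ring
    _ ≤ 5 ^ d * ∑' x : u, ∫⁻ y in Metric.closedBall (x : EuclideanSpace ℝ (Fin d)) (ρ x), g y := by
        gcongr with x
        exact hρA x (huA x.2)
    _ = 5 ^ d * ∫⁻ y in ⋃ x ∈ u, Metric.closedBall x (ρ x), g y := by
        rw [lintegral_biUnion huc (fun _ _ => Metric.isClosed_closedBall.measurableSet) hdis]
    _ ≤ 5 ^ d * ∫⁻ x, g x := by
        gcongr
        exact Measure.restrict_le_self

/-- Weak type estimate for the maximal function, in truncated form. -/
theorem mul_volume_hardyLittlewood_gt_le {d : ℕ} (hd : 0 < d)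
    {f : EuclideanSpace ℝ (Fin d) → ℂ} (hf : AEMeasurable f volume)
    (hfi : ∫⁻ x, ‖f x‖ₑ ≠ ∞) {t : ℝ} (ht : 0 < t) :
    ENNReal.ofReal t * volume {x | ENNReal.ofReal (2 * t) < hardyLittlewood f x} ≤
      5 ^ d * ∫⁻ x in {x | t < ‖f x‖}, ‖f x‖ₑ := by
  have hS : NullMeasurableSet {x | t < ‖f x‖} volume :=
    nullMeasurableSet_lt aemeasurable_const hf.norm
  rw [← lintegral_indicator₀ hS]
  set g := Set.indicator {x | t < ‖f x‖} fun x => ‖f x‖ₑ with hgdef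
  have hle : ∀ x, ‖f x‖ₑ ≤ g x + ENNReal.ofReal t := by
    intro x
    by_cases hx : t < ‖f x‖
    · simp [hgdef, Set.indicator_of_mem (show x ∈ {x | t < ‖f x‖} from hx)]
    · rw [← ofReal_norm]
      exact le_add_left (ENNReal.ofReal_le_ofReal (not_lt.1 hx))
  refine mul_volume_le_lintegral_of_averages hd ?_ (by simpa using ht) ?_
  · exact ne_top_of_le_ne_top hfi
      (lintegral_mono fun x => Set.indicator_le_self _ _ x)
  · intro x hx
    simp only [Set.mem_ofPred_eq, hardyLittlewood, lt_iSup_iff] at hx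
    obtain ⟨ρ, hρ, hx⟩ := hx
    refine ⟨ρ, hρ, ?_⟩
    have : Nontrivial (EuclideanSpace ℝ (Fin d)) := by
      have : Nonempty (Fin d) := ⟨⟨0, hd⟩⟩
      infer_instance
    have hv0 : volume (Metric.ball x ρ) ≠ 0 := (Metric.measure_ball_pos volume x hρ).ne'
    have hvt : volume (Metric.ball x ρ) ≠ ∞ := measure_ball_lt_top.ne
    rw [Measure.addHaar_closedBall_eq_addHaar_ball]
    have h1 : ENNReal.ofReal (2 * t) * volume (Metric.ball x ρ) ≤
        ∫⁻ y in Metric.ball x ρ, ‖f y‖ₑ := by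
      rw [← ENNReal.div_eq_inv_mul, ENNReal.lt_div_iff_mul_lt (Or.inl hv0) (Or.inl hvt)] at hx
      exact hx.le
    have h2 : ∫⁻ y in Metric.ball x ρ, ‖f y‖ₑ ≤
        (∫⁻ y in Metric.ball x ρ, g y) + ENNReal.ofReal t * volume (Metric.ball x ρ) := by
      calc _ ≤ ∫⁻ y in Metric.ball x ρ, (g y + ENNReal.ofReal t) := lintegral_mono hle
        _ = _ := by rw [lintegral_add_right _ measurable_const, setLIntegral_const]
    have h3 := h1.trans h2
    rw [two_mul, ENNReal.ofReal_add ht.le ht.le, add_mul] at h3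
    have h4 := (ENNReal.add_le_add_iff_right
      (ENNReal.mul_ne_top ENNReal.ofReal_ne_top hvt)).1 h3
    exact h4.trans (lintegral_mono_set Metric.ball_subset_closedBall)

/-- Averages over closed balls bound the maximal function at every point of the ball. -/
theorem le_mul_hardyLittlewood_of_average {d : ℕ} {f : EuclideanSpace ℝ (Fin d) → ℂ}
    {t : ℝ≥0∞} {x y : EuclideanSpace ℝ (Fin d)} {ρ : ℝ} (hρ : 0 < ρ)
    (h : t * volume (Metric.closedBall x ρ) ≤ ∫⁻ z in Metric.closedBall x ρ, ‖f z‖ₑ)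
    (hy : y ∈ Metric.closedBall x ρ) : t ≤ 4 ^ d * hardyLittlewood f y := by
  have hsub : Metric.closedBall x ρ ⊆ Metric.ball y (4 * ρ) := by
    intro z hz
    rw [Metric.mem_closedBall] at hz hy
    rw [Metric.mem_ball]
    linarith [dist_triangle_right z y x]
  set w := volume (Metric.ball y (4 * ρ)) with hw
  have hw0 : w ≠ 0 := (Metric.measure_ball_pos volume y (by positivity)).ne'
  have hwt : w ≠ ∞ := measure_ball_lt_top.ne
  have hwle : w ≤ 4 ^ d * volume (Metric.closedBall x ρ) := by
    calc w ≤ volume (Metric.closedBall y (4 * ρ)) := measure_mono Metric.ball_subset_closedBall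
      _ = _ := by
        rw [volume_closedBall_scale y x (by norm_num) hρ.le, ENNReal.ofReal_pow (by norm_num)]
        norm_num
  have hM : w⁻¹ * ∫⁻ z in Metric.ball y (4 * ρ), ‖f z‖ₑ ≤ hardyLittlewood f y :=
    le_iSup₂_of_le (4 * ρ) (by positivity) le_rfl
  calc t = w⁻¹ * (t * w) := by
        rw [mul_left_comm, ENNReal.inv_mul_cancel hw0 hwt, mul_one]
    _ ≤ w⁻¹ * (t * (4 ^ d * volume (Metric.closedBall x ρ))) := by gcongr
    _ = 4 ^ d * (w⁻¹ * (t * volume (Metric.closedBall x ρ))) := by ring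
    _ ≤ 4 ^ d * (w⁻¹ * ∫⁻ z in Metric.ball y (4 * ρ), ‖f z‖ₑ) := by
        gcongr
        exact h.trans (lintegral_mono_set hsub)
    _ ≤ _ := by gcongr

/-- A closed ball centred in another closed ball of larger radius meets it in a comparable ball. -/
theorem exists_closedBall_half_subset_inter {E : Type*} [NormedAddCommGroup E] [NormedSpace ℝ E]
    {x₀ x : E} {r ρ : ℝ} (hr : 0 < r) (hρ : 0 ≤ ρ) (hρr : ρ ≤ r)
    (hx : x ∈ Metric.closedBall x₀ r) :
    ∃ z, Metric.closedBall z (ρ / 2) ⊆ Metric.closedBall x₀ r ∩ Metric.closedBall x ρ := by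
  have hdx : dist x x₀ ≤ r := hx
  set c := ρ / (2 * r) with hc
  have hcr : c * r = ρ / 2 := by rw [hc]; field_simp
  have hc0 : 0 ≤ c := by positivity
  have hc1 : c ≤ 1 := by rw [hc, div_le_one (by positivity)]; linarith
  refine ⟨AffineMap.lineMap x x₀ c, Set.subset_inter ?_ ?_⟩
  · refine Metric.closedBall_subset_closedBall' ?_
    rw [dist_lineMap_right, Real.norm_of_nonneg (by linarith)]
    nlinarith
  · refine Metric.closedBall_subset_closedBall' ?_
    rw [dist_lineMap_left, Real.norm_of_nonneg hc0]
    nlinarith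

/-- Reverse weak type estimate on a ball, for large heights. -/
theorem setLIntegral_gt_le_mul_volume {d : ℕ} {f : EuclideanSpace ℝ (Fin d) → ℂ}
    (hf : AEMeasurable f volume) (hfi : ∫⁻ x, ‖f x‖ₑ ≠ ∞)
    {x₀ : EuclideanSpace ℝ (Fin d)} {r : ℝ} (hr : 0 < r)
    (hsupp : ∀ x, x ∉ Metric.closedBall x₀ r → f x = 0) {t : ℝ} (ht : 0 < t)
    (htr : ∫⁻ x, ‖f x‖ₑ ≤ ENNReal.ofReal t * volume (Metric.closedBall x₀ r)) :
    ∫⁻ x in {x | t < ‖f x‖}, ‖f x‖ₑ ≤ 16 ^ d * (ENNReal.ofReal t *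
      volume (Metric.closedBall x₀ r ∩ {y | ENNReal.ofReal t ≤ 4 ^ d * hardyLittlewood f y})) := by
  set T := ENNReal.ofReal t with hT
  have hae := (Besicovitch.vitaliFamily
    (volume : Measure (EuclideanSpace ℝ (Fin d)))).ae_tendsto_lintegral_div hf.enorm hfi
  set A : Set (EuclideanSpace ℝ (Fin d)) := {x | ∃ ρ : ℝ, 0 < ρ ∧ ρ ≤ r ∧
    x ∈ Metric.closedBall x₀ r ∧
    T * volume (Metric.closedBall x ρ) ≤ ∫⁻ y in Metric.closedBall x ρ, ‖f y‖ₑ ∧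
    ∫⁻ y in Metric.closedBall x (8 * ρ), ‖f y‖ₑ ≤ T * volume (Metric.closedBall x (8 * ρ))} with hA
  have hmem : ∀ᵐ x, x ∈ {x | t < ‖f x‖} → x ∈ A := by
    filter_upwards [hae] with x hx htx
    have hxB : x ∈ Metric.closedBall x₀ r := by
      by_contra hcon
      have := hsupp x hcon
      simp only [this, norm_zero] at htx
      linarith
    have hx' := hx.comp (Besicovitch.tendsto_filterAt volume x)
    have hr2 : Filter.Tendsto (fun j : ℕ => r * (1 / 2 : ℝ) ^ j) Filter.atTop
        (nhdsWithin 0 (Set.Ioi 0)) := by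
      refine tendsto_nhdsWithin_iff.2 ⟨?_, .of_forall fun j => ?_⟩
      · simpa using (tendsto_pow_atTop_nhds_zero_of_lt_one
          (by norm_num : (0 : ℝ) ≤ 1 / 2) (by norm_num)).const_mul r
      · simp only [Set.mem_Ioi]; positivity
    have hx'' := hx'.comp hr2
    have hTx : T < ‖f x‖ₑ := by
      rw [hT, ← ofReal_norm]
      exact (ENNReal.ofReal_lt_ofReal_iff (ht.trans htx)).2 htx
    have hex : ∃ j : ℕ, T * volume (Metric.closedBall x (r * (1 / 2 : ℝ) ^ j)) <
        ∫⁻ y in Metric.closedBall x (r * (1 / 2 : ℝ) ^ j), ‖f y‖ₑ := by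
      obtain ⟨j, hj⟩ := (hx''.eventually_const_lt hTx).exists
      refine ⟨j, ?_⟩
      simp only [Function.comp_apply] at hj
      rwa [ENNReal.lt_div_iff_mul_lt
        (Or.inl (Metric.measure_closedBall_pos volume x (by positivity)).ne')
        (Or.inl measure_closedBall_lt_top.ne)] at hj
    classical
    set j := Nat.find hex with hj
    have hpow : (1 / 2 : ℝ) ^ j ≤ 1 := pow_le_one₀ (by norm_num) (by norm_num)
    refine ⟨r * (1 / 2 : ℝ) ^ j, by positivity, by nlinarith, hxB, (Nat.find_spec hex).le, ?_⟩
    by_cases hj3 : 3 ≤ j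
    · have hmin := Nat.find_min hex (show j - 3 < Nat.find hex by omega)
      have he : 8 * (r * (1 / 2 : ℝ) ^ j) = r * (1 / 2 : ℝ) ^ (j - 3) := by
        conv_lhs => rw [← Nat.sub_add_cancel hj3, pow_add]
        ring
      rw [he]
      exact not_lt.1 hmin
    · have hj2 : j ≤ 2 := by omega
      have hp : (1 / 2 : ℝ) ^ 2 ≤ (1 / 2 : ℝ) ^ j :=
        pow_le_pow_of_le_one (by norm_num) (by norm_num) hj2
      calc _ ≤ ∫⁻ x, ‖f x‖ₑ := setLIntegral_le_lintegral _ _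
        _ ≤ T * volume (Metric.closedBall x r) := by
          rwa [Measure.addHaar_closedBall_center volume x,
            ← Measure.addHaar_closedBall_center volume x₀]
        _ ≤ _ := by
          gcongr
          nlinarith
  have hAspec : ∀ x ∈ A, _ := fun x hx => hx
  choose! ρ hρ hρr hxB hlow hup using hAspec
  obtain ⟨u, huA, huc, hdis, hcov⟩ := exists_countable_disjoint_closedBall_cover A ρ r hρ hρr
  have hz : ∀ x ∈ A, ∃ z, Metric.closedBall z (ρ x / 2) ⊆
      Metric.closedBall x₀ r ∩ Metric.closedBall x (ρ x) := fun x hx =>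
    exists_closedBall_half_subset_inter hr (hρ x hx).le (hρr x hx) (hxB x hx)
  choose! z hz using hz
  have hzdis : u.PairwiseDisjoint fun x => Metric.closedBall (z x) (ρ x / 2) :=
    fun x hx y hy hxy => (hdis hx hy hxy).mono
      ((hz x (huA hx)).trans Set.inter_subset_right)
      ((hz y (huA hy)).trans Set.inter_subset_right)
  calc ∫⁻ x in {x | t < ‖f x‖}, ‖f x‖ₑ
      ≤ ∫⁻ x in ⋃ x ∈ u, Metric.closedBall x (8 * ρ x), ‖f x‖ₑ := by
        refine lintegral_mono_set' ?_
        filter_upwards [hmem] with x hx htx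
        have h1 := hcov (hx htx)
        simp only [Set.mem_iUnion] at h1
        obtain ⟨y, hy, hxy⟩ := h1
        have hp := hρ y (huA hy)
        exact Set.mem_biUnion hy (Metric.closedBall_subset_closedBall (by linarith) hxy)
    _ ≤ ∑' x : u, ∫⁻ y in Metric.closedBall (x : EuclideanSpace ℝ (Fin d)) (8 * ρ x), ‖f y‖ₑ := by
        rw [Set.biUnion_eq_iUnion]
        have := huc.to_subtype
        exact lintegral_iUnion_le _ _
    _ ≤ ∑' x : u, T * volume (Metric.closedBall (x : EuclideanSpace ℝ (Fin d)) (8 * ρ x)) := by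
        gcongr with x
        exact hup x (huA x.2)
    _ = 16 ^ d * (T * ∑' x : u, volume (Metric.closedBall (z x) (ρ x / 2))) := by
        rw [← ENNReal.tsum_mul_left, ← ENNReal.tsum_mul_left]
        refine tsum_congr fun x => ?_
        have hp := hρ x (huA x.2)
        rw [show 8 * ρ x = 16 * (ρ x / 2) by ring,
          volume_closedBall_scale x.1 (z x) (by norm_num) (by positivity),
          ENNReal.ofReal_pow (by norm_num)]
        norm_num
        ring
    _ = 16 ^ d * (T * volume (⋃ x ∈ u, Metric.closedBall (z x) (ρ x / 2))) := by
        rw [measure_biUnion huc hzdis fun _ _ => Metric.isClosed_closedBall.measurableSet]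
    _ ≤ _ := by
        gcongr
        refine Set.iUnion₂_subset fun x hx y hy => ?_
        have h1 := hz x (huA hx) hy
        exact ⟨h1.1, le_mul_hardyLittlewood_of_average (hρ x (huA hx)) (hlow x (huA hx)) h1.2⟩

/-- An integrand whose primitive is increasing is nonnegative almost everywhere. -/
theorem ae_nonneg_of_monotoneOn_primitive {ψ : ℝ → ℝ}
    (hint : ∀ t, 0 ≤ t → IntervalIntegrable ψ volume 0 t)
    (hmono : MonotoneOn (fun t => ∫ s in (0 : ℝ)..t, ψ s) (Set.Ici 0)) {b : ℝ} (hb : 0 ≤ b) :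
    ∀ᵐ s, s ∈ Set.Icc 0 b → 0 ≤ ψ s := by
  have h0 : ∀ᵐ x : ℝ, x ≠ 0 := by simp [ae_iff, measure_singleton]
  filter_upwards [(hint b hb).ae_hasDerivAt_integral, h0] with s hs hs0 hsb
  have h := hs (by rwa [Set.uIcc_of_le hb]) 0 (by simp)
  have hpos : 0 < s := lt_of_le_of_ne hsb.1 (Ne.symm hs0)
  refine (h.hasDerivWithinAt (s := Set.Ioi 0)).nonneg_of_monotoneOn ?_
    (hmono.mono Set.Ioi_subset_Ici_self)
  have hacc : AccPt s (Filter.principal Set.univ) := PerfectSpace.univ_preperfect _ (Set.mem_univ _)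
  rw [accPt_iff_nhds] at hacc ⊢
  intro U hU
  obtain ⟨y, hy, hne⟩ := hacc (U ∩ Set.Ioi 0) (Filter.inter_mem hU (Ioi_mem_nhds hpos))
  exact ⟨y, hy.1, hne⟩

theorem integral_div_le {ψ : ℝ → ℝ}
    (hint : ∀ t, 0 ≤ t → IntervalIntegrable ψ volume 0 t)
    (hmono : MonotoneOn (fun t => ∫ s in (0 : ℝ)..t, ψ s) (Set.Ici 0))
    (hdiv : ∀ α₀ β₀ : ℝ, 0 < α₀ → α₀ < β₀ → IntervalIntegrable (fun s => ψ s / s) volume α₀ β₀)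
    {a b : ℝ} (ha : 0 < a) (hab : a ≤ b) :
    ∫ s in a..b, ψ s / s ≤ ((∫ s in (0 : ℝ)..b, ψ s) - ∫ s in (0 : ℝ)..a, ψ s) / a := by
  rcases hab.eq_or_lt with rfl | hlt
  · simp
  have hb := ha.le.trans hab
  rw [intervalIntegral.integral_interval_sub_left (hint b hb) (hint a ha.le),
    ← intervalIntegral.integral_div]
  refine intervalIntegral.integral_mono_ae_restrict hab (hdiv a b ha hlt)
    (((hint a ha.le).symm.trans (hint b hb)).div_const a) ?_
  refine (ae_restrict_iff' measurableSet_Icc).2 ?_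
  filter_upwards [ae_nonneg_of_monotoneOn_primitive hint hmono hb] with s hs hsab
  exact div_le_div_of_nonneg_left (hs ⟨ha.le.trans hsab.1, hsab.2⟩) ha hsab.1

theorem le_integral_div {ψ : ℝ → ℝ}
    (hint : ∀ t, 0 ≤ t → IntervalIntegrable ψ volume 0 t)
    (hmono : MonotoneOn (fun t => ∫ s in (0 : ℝ)..t, ψ s) (Set.Ici 0))
    (hdiv : ∀ α₀ β₀ : ℝ, 0 < α₀ → α₀ < β₀ → IntervalIntegrable (fun s => ψ s / s) volume α₀ β₀)
    {a b : ℝ} (ha : 0 < a) (hab : a ≤ b) :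
    ((∫ s in (0 : ℝ)..b, ψ s) - ∫ s in (0 : ℝ)..a, ψ s) / b ≤ ∫ s in a..b, ψ s / s := by
  rcases hab.eq_or_lt with rfl | hlt
  · simp
  have hb := ha.le.trans hab
  rw [intervalIntegral.integral_interval_sub_left (hint b hb) (hint a ha.le),
    ← intervalIntegral.integral_div]
  refine intervalIntegral.integral_mono_ae_restrict hab
    (((hint a ha.le).symm.trans (hint b hb)).div_const b) (hdiv a b ha hlt) ?_
  refine (ae_restrict_iff' measurableSet_Icc).2 ?_
  filter_upwards [ae_nonneg_of_monotoneOn_primitive hint hmono hb] with s hs hsab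
  exact div_le_div_of_nonneg_left (hs ⟨ha.le.trans hsab.1, hsab.2⟩) (ha.trans_le hsab.1) hsab.2

theorem integral_div_nonneg {ψ : ℝ → ℝ}
    (hint : ∀ t, 0 ≤ t → IntervalIntegrable ψ volume 0 t)
    (hmono : MonotoneOn (fun t => ∫ s in (0 : ℝ)..t, ψ s) (Set.Ici 0))
    (hdiv : ∀ α₀ β₀ : ℝ, 0 < α₀ → α₀ < β₀ → IntervalIntegrable (fun s => ψ s / s) volume α₀ β₀)
    {a b : ℝ} (ha : 0 < a) (hab : a ≤ b) :
    0 ≤ ∫ s in a..b, ψ s / s := by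
  refine le_trans (div_nonneg (sub_nonneg.2 ?_) (ha.le.trans hab))
    (le_integral_div hint hmono hdiv ha hab)
  exact hmono ha.le (ha.le.trans hab) hab

theorem integral_div_add {ψ : ℝ → ℝ}
    (hdiv : ∀ α₀ β₀ : ℝ, 0 < α₀ → α₀ < β₀ → IntervalIntegrable (fun s => ψ s / s) volume α₀ β₀)
    {a b c : ℝ} (ha : 0 < a) (hab : a ≤ b) (hbc : b ≤ c) :
    ∫ s in a..c, ψ s / s = (∫ s in a..b, ψ s / s) + ∫ s in b..c, ψ s / s := by
  rcases hab.eq_or_lt with rfl | h1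
  · simp
  rcases hbc.eq_or_lt with rfl | h2
  · simp
  exact (intervalIntegral.integral_add_adjacent_intervals (hdiv a b ha h1)
    (hdiv b c (ha.trans h1) h2)).symm

theorem integral_div_mono {ψ : ℝ → ℝ}
    (hint : ∀ t, 0 ≤ t → IntervalIntegrable ψ volume 0 t)
    (hmono : MonotoneOn (fun t => ∫ s in (0 : ℝ)..t, ψ s) (Set.Ici 0))
    (hdiv : ∀ α₀ β₀ : ℝ, 0 < α₀ → α₀ < β₀ → IntervalIntegrable (fun s => ψ s / s) volume α₀ β₀)
    {a b c : ℝ} (ha : 0 < a) (hab : a ≤ b) (hbc : b ≤ c) :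
    ∫ s in a..b, ψ s / s ≤ ∫ s in a..c, ψ s / s := by
  rw [integral_div_add hdiv ha hab hbc]
  linarith [integral_div_nonneg hint hmono hdiv (ha.trans_le hab) hbc]

theorem integral_div_le_sum_increments {ψ : ℝ → ℝ}
    (hint : ∀ t, 0 ≤ t → IntervalIntegrable ψ volume 0 t)
    (hmono : MonotoneOn (fun t => ∫ s in (0 : ℝ)..t, ψ s) (Set.Ici 0))
    (hdiv : ∀ α₀ β₀ : ℝ, 0 < α₀ → α₀ < β₀ → IntervalIntegrable (fun s => ψ s / s) volume α₀ β₀)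
    {α : ℝ} (hα : 0 < α) (N : ℕ) :
    ∫ s in α..(2 ^ N * α), ψ s / s ≤ ∑ j ∈ Finset.range N,
      ((∫ s in (0 : ℝ)..(2 ^ (j + 1) * α), ψ s) - ∫ s in (0 : ℝ)..(2 ^ j * α), ψ s) /
        (2 ^ j * α) := by
  induction N with
  | zero => simp
  | succ N ih =>
    have h1 : (1 : ℝ) ≤ 2 ^ N := one_le_pow₀ (by norm_num)
    have h2 : (2 : ℝ) ^ N * α ≤ 2 ^ (N + 1) * α := by gcongr <;> norm_num
    rw [Finset.sum_range_succ, integral_div_add hdiv hα (by nlinarith) h2]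
    exact add_le_add ih (integral_div_le hint hmono hdiv (by positivity) h2)

theorem sum_increments_le_integral_div {ψ : ℝ → ℝ}
    (hint : ∀ t, 0 ≤ t → IntervalIntegrable ψ volume 0 t)
    (hmono : MonotoneOn (fun t => ∫ s in (0 : ℝ)..t, ψ s) (Set.Ici 0))
    (hdiv : ∀ α₀ β₀ : ℝ, 0 < α₀ → α₀ < β₀ → IntervalIntegrable (fun s => ψ s / s) volume α₀ β₀)
    {α : ℝ} (hα : 0 < α) (N : ℕ) :
    ∑ j ∈ Finset.range N,
      ((∫ s in (0 : ℝ)..(2 ^ (j + 1) * α), ψ s) - ∫ s in (0 : ℝ)..(2 ^ j * α), ψ s) /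
        (2 ^ j * α) ≤ 2 * ∫ s in α..(2 ^ N * α), ψ s / s := by
  induction N with
  | zero => simp
  | succ N ih =>
    have h1 : (1 : ℝ) ≤ 2 ^ N := one_le_pow₀ (by norm_num)
    have h2 : (2 : ℝ) ^ N * α ≤ 2 ^ (N + 1) * α := by gcongr <;> norm_num
    rw [Finset.sum_range_succ, integral_div_add hdiv hα (by nlinarith) h2, mul_add]
    refine add_le_add ih ?_
    refine le_trans (le_of_eq ?_) (mul_le_mul_of_nonneg_left
      (le_integral_div hint hmono hdiv (by positivity) h2) (by norm_num))
    rw [pow_succ]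
    field_simp

/-- Summation by parts for dyadic sums. -/
theorem sum_dyadic_add_eq (φ : ℝ → ℝ) {α : ℝ} (hα : 0 < α) (N : ℕ) :
    ∑ k ∈ Finset.range (N + 1), φ (2 ^ k * α) / (2 ^ k * α) + φ (2 ^ N * α) / (2 ^ N * α) =
      2 * φ α / α + ∑ j ∈ Finset.range N,
        (φ (2 ^ (j + 1) * α) - φ (2 ^ j * α)) / (2 ^ j * α) := by
  induction N with
  | zero => simp; ring
  | succ N ih =>
    rw [Finset.sum_range_succ _ (N + 1), Finset.sum_range_succ
      (fun j => (φ (2 ^ (j + 1) * α) - φ (2 ^ j * α)) / (2 ^ j * α)) N, ← add_assoc, ← ih]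
    generalize ∑ k ∈ Finset.range (N + 1), φ (2 ^ k * α) / (2 ^ k * α) = S
    generalize φ (2 ^ (N + 1) * α) = p
    generalize φ (2 ^ N * α) = q
    rw [pow_succ]
    field_simp
    ring

/-- Every number above `α` lies in one of the dyadic intervals `(2 ^ N α, 2 ^ (N + 1) α]`. -/
theorem exists_dyadic_interval {α u : ℝ} (hα : 0 < α) (hu : α < u) :
    ∃ N : ℕ, 2 ^ N * α < u ∧ u ≤ 2 ^ (N + 1) * α := by
  classical
  have hex : ∃ n : ℕ, u ≤ 2 ^ n * α := by
    obtain ⟨n, hn⟩ := pow_unbounded_of_one_lt (u / α) (by norm_num : (1 : ℝ) < 2)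
    exact ⟨n, ((div_lt_iff₀ hα).1 hn).le⟩
  have h0 : Nat.find hex ≠ 0 := fun h => by
    have := Nat.find_spec hex
    rw [h] at this
    simp only [pow_zero, one_mul] at this
    linarith
  refine ⟨Nat.find hex - 1, not_le.1 (Nat.find_min hex (by omega)), ?_⟩
  rw [Nat.sub_add_cancel (by omega)]
  exact Nat.find_spec hex

theorem dyadic_lt_iff {α u : ℝ} (hα : 0 < α) {N : ℕ} (h1 : 2 ^ N * α < u)
    (h2 : u ≤ 2 ^ (N + 1) * α) (k : ℕ) : 2 ^ k * α < u ↔ k < N + 1 := by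
  constructor
  · intro h
    have h3 : (2 : ℝ) ^ k < 2 ^ (N + 1) := lt_of_mul_lt_mul_right (h.trans_le h2) hα.le
    exact (pow_lt_pow_iff_right₀ (by norm_num)).1 h3
  · intro h
    refine lt_of_le_of_lt ?_ h1
    gcongr
    · norm_num
    · omega

theorem tsum_ite_lt (c : ℕ → ℝ≥0∞) (N : ℕ) :
    ∑' k, (if k < N then c k else 0) = ∑ k ∈ Finset.range N, c k := by
  rw [tsum_eq_sum (s := Finset.range N)]
  · exact Finset.sum_congr rfl fun k hk => if_pos (Finset.mem_range.1 hk)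
  · intro k hk
    exact if_neg fun h => hk (Finset.mem_range.2 h)

/-- The dyadic version of `∫_α^u φ(s) / s² ds`. -/
noncomputable def dyadicWeight (φ : ℝ → ℝ) (α u : ℝ) : ℝ≥0∞ :=
  ∑' k : ℕ, if 2 ^ k * α < u then ENNReal.ofReal (φ (2 ^ k * α) / (2 ^ k * α)) else 0

theorem dyadicWeight_of_le {φ : ℝ → ℝ} {α u : ℝ} (hα : 0 < α) (hu : u ≤ α) :
    dyadicWeight φ α u = 0 := by
  rw [dyadicWeight, ENNReal.tsum_eq_zero]
  intro k
  have : (1 : ℝ) ≤ 2 ^ k := one_le_pow₀ (by norm_num)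
  exact if_neg (by nlinarith)

theorem dyadicWeight_eq_sum {φ : ℝ → ℝ} (hφ : ∀ t, 0 < t → 0 ≤ φ t) {α u : ℝ} (hα : 0 < α)
    {N : ℕ} (h1 : 2 ^ N * α < u) (h2 : u ≤ 2 ^ (N + 1) * α) :
    dyadicWeight φ α u =
      ENNReal.ofReal (∑ k ∈ Finset.range (N + 1), φ (2 ^ k * α) / (2 ^ k * α)) := by
  rw [dyadicWeight]
  simp only [dyadic_lt_iff hα h1 h2]
  rw [tsum_ite_lt, ENNReal.ofReal_sum_of_nonneg]
  intro k _
  exact div_nonneg (hφ _ (by positivity)) (by positivity)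

/-- Comparable functions have comparable dyadic weights. -/
theorem dyadicWeight_le_mul {φ χ : ℝ → ℝ} {C : ℝ} (hC : 0 ≤ C)
    (h : ∀ t, 0 < t → φ t ≤ C * χ t) {α : ℝ} (hα : 0 < α) (u : ℝ) :
    dyadicWeight φ α u ≤ ENNReal.ofReal C * dyadicWeight χ α u := by
  rw [dyadicWeight, dyadicWeight, ← ENNReal.tsum_mul_left]
  refine ENNReal.tsum_le_tsum fun k => ?_
  split_ifs
  · rw [← ENNReal.ofReal_mul hC, ← mul_div_assoc]
    gcongr
    exact h _ (by positivity)
  · simp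

theorem ofReal_integral_div_le_dyadicWeight {ψ φ : ℝ → ℝ} (hφ : φ = fun t => ∫ s in (0 : ℝ)..t, ψ s)
    (hint : ∀ t, 0 ≤ t → IntervalIntegrable ψ volume 0 t) (hmono : MonotoneOn φ (Set.Ici 0))
    (hdiv : ∀ α₀ β₀ : ℝ, 0 < α₀ → α₀ < β₀ → IntervalIntegrable (fun s => ψ s / s) volume α₀ β₀)
    (hpos : ∀ t, 0 < t → 0 < φ t) {C₀ : ℝ} (hC₀ : 0 < C₀) (hdbl : ∀ t, 0 ≤ t → φ (2 * t) ≤ C₀ * φ t)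
    {α u : ℝ} (hα : 0 < α) (hu : α < u) :
    ENNReal.ofReal (∫ s in α..u, ψ s / s) ≤ ENNReal.ofReal (1 + C₀) * dyadicWeight φ α u := by
  obtain ⟨N, h1, h2⟩ := exists_dyadic_interval hα hu
  rw [dyadicWeight_eq_sum (fun t ht => (hpos t ht).le) hα h1 h2, ← ENNReal.ofReal_mul (by positivity)]
  refine ENNReal.ofReal_le_ofReal ?_
  have e1 := integral_div_mono hint (hφ ▸ hmono) hdiv hα hu.le h2
  have e2 := integral_div_le_sum_increments hint (hφ ▸ hmono) hdiv hα (N + 1)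
  have e3 := sum_dyadic_add_eq φ hα (N + 1)
  have e4 : φ (2 ^ (N + 1) * α) / (2 ^ (N + 1) * α) ≤ C₀ / 2 * (φ (2 ^ N * α) / (2 ^ N * α)) := by
    have := hdbl (2 ^ N * α) (by positivity)
    rw [show (2 : ℝ) ^ (N + 1) * α = 2 * (2 ^ N * α) by ring, div_mul_div_comm]
    gcongr
  have e5 : 0 < φ α / α := div_pos (hpos α hα) hα
  have e6 : φ (2 ^ N * α) / (2 ^ N * α) ≤
      ∑ k ∈ Finset.range (N + 1), φ (2 ^ k * α) / (2 ^ k * α) :=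
    Finset.single_le_sum (f := fun k => φ (2 ^ k * α) / (2 ^ k * α))
      (fun k _ => div_nonneg (hpos _ (by positivity)).le (by positivity))
      (Finset.mem_range.2 (Nat.lt_succ_self N))
  rw [Finset.sum_range_succ _ (N + 1)] at e3
  have e7 := mul_le_mul_of_nonneg_left e6 hC₀.le
  simp only [hφ] at e3 e4 e5 e6 e7 ⊢
  rw [mul_div_assoc] at e3
  linarith

theorem dyadicWeight_le_integral_div {ψ φ : ℝ → ℝ} (hφ : φ = fun t => ∫ s in (0 : ℝ)..t, ψ s)
    (hint : ∀ t, 0 ≤ t → IntervalIntegrable ψ volume 0 t) (hmono : MonotoneOn φ (Set.Ici 0))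
    (hdiv : ∀ α₀ β₀ : ℝ, 0 < α₀ → α₀ < β₀ → IntervalIntegrable (fun s => ψ s / s) volume α₀ β₀)
    (hpos : ∀ t, 0 < t → 0 < φ t) {α u : ℝ} (hα : 0 < α) (hu : α < u) :
    dyadicWeight φ α u ≤
      ENNReal.ofReal (2 * φ α / α) + 2 * ENNReal.ofReal (∫ s in α..u, ψ s / s) := by
  obtain ⟨N, h1, h2⟩ := exists_dyadic_interval hα hu
  have h3 : α ≤ 2 ^ N * α := by
    have : (1 : ℝ) ≤ 2 ^ N := one_le_pow₀ (by norm_num)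
    nlinarith
  have e1 := integral_div_mono hint (hφ ▸ hmono) hdiv hα h3 h1.le
  have e2 := sum_increments_le_integral_div hint (hφ ▸ hmono) hdiv hα N
  have e3 := sum_dyadic_add_eq φ hα N
  have e4 : 0 < φ (2 ^ N * α) / (2 ^ N * α) := div_pos (hpos _ (by positivity)) (by positivity)
  have e5 := integral_div_nonneg hint (hφ ▸ hmono) hdiv hα hu.le
  have e6 : 0 < 2 * φ α / α := div_pos (mul_pos two_pos (hpos α hα)) hα
  rw [dyadicWeight_eq_sum (fun t ht => (hpos t ht).le) hα h1 h2,
    show (2 : ℝ≥0∞) = ENNReal.ofReal 2 by simp, ← ENNReal.ofReal_mul (by norm_num),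
    ← ENNReal.ofReal_add e6.le (by positivity)]
  refine ENNReal.ofReal_le_ofReal ?_
  simp only [hφ] at e3 e4 ⊢
  linarith

theorem dyadicWeight_le_tsum_increments {φ : ℝ → ℝ} (hmono : MonotoneOn φ (Set.Ici 0))
    (hpos : ∀ t, 0 < t → 0 < φ t) {α : ℝ} (hα : 0 < α) (u : ℝ) :
    dyadicWeight φ α u ≤ ENNReal.ofReal (2 * φ α / α) +
      ∑' j : ℕ, if 2 ^ (j + 1) * α < u then
        ENNReal.ofReal ((φ (2 ^ (j + 1) * α) - φ (2 ^ j * α)) / (2 ^ j * α)) else 0 := by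
  rcases le_or_gt u α with hu | hu
  · simp [dyadicWeight_of_le hα hu]
  obtain ⟨N, h1, h2⟩ := exists_dyadic_interval hα hu
  have e3 := sum_dyadic_add_eq φ hα N
  have e4 : 0 < φ (2 ^ N * α) / (2 ^ N * α) := div_pos (hpos _ (by positivity)) (by positivity)
  have e6 : 0 < 2 * φ α / α := div_pos (mul_pos two_pos (hpos α hα)) hα
  have e7 : ∀ j ∈ Finset.range N, 0 ≤ (φ (2 ^ (j + 1) * α) - φ (2 ^ j * α)) / (2 ^ j * α) := by
    intro j _
    refine div_nonneg (sub_nonneg.2 (hmono ?_ ?_ ?_)) (by positivity)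
    · simp only [Set.mem_Ici]; positivity
    · simp only [Set.mem_Ici]; positivity
    · gcongr <;> norm_num
  rw [dyadicWeight_eq_sum (fun t ht => (hpos t ht).le) hα h1 h2]
  simp only [dyadic_lt_iff hα h1 h2, Nat.add_lt_add_iff_right]
  rw [tsum_ite_lt, ← ENNReal.ofReal_sum_of_nonneg e7,
    ← ENNReal.ofReal_add e6.le (Finset.sum_nonneg e7)]
  exact ENNReal.ofReal_le_ofReal (by linarith)

/-- Telescoping of dyadic increments. -/
theorem sum_ofReal_increments {φ : ℝ → ℝ} (hmono : MonotoneOn φ (Set.Ici 0)) {β : ℝ} (hβ : 0 < β)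
    (n : ℕ) : ∑ j ∈ Finset.range n, ENNReal.ofReal (φ (2 ^ (j + 1) * β) - φ (2 ^ j * β)) =
      ENNReal.ofReal (φ (2 ^ n * β) - φ β) := by
  rw [← ENNReal.ofReal_sum_of_nonneg, Finset.sum_range_sub fun j => φ (2 ^ j * β)]
  · simp
  · intro j _
    refine sub_nonneg.2 (hmono ?_ ?_ ?_)
    · simp only [Set.mem_Ici]; positivity
    · simp only [Set.mem_Ici]; positivity
    · gcongr <;> norm_num

theorem tsum_increments_le {φ : ℝ → ℝ} (hmono : MonotoneOn φ (Set.Ici 0))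
    (hnn : ∀ t, 0 ≤ t → 0 ≤ φ t) {α v : ℝ} (hα : 0 < α) :
    ∑' j : ℕ, (if 2 ^ (j + 1) * α ≤ v then
      ENNReal.ofReal (φ (2 ^ (j + 1) * α) - φ (2 ^ j * α)) else 0) ≤ ENNReal.ofReal (φ v) := by
  refine ENNReal.tsum_le_of_sum_range_le fun n => ?_
  induction n with
  | zero => simp
  | succ n ih =>
    by_cases h : 2 ^ (n + 1) * α ≤ v
    · calc _ ≤ ∑ j ∈ Finset.range (n + 1),
            ENNReal.ofReal (φ (2 ^ (j + 1) * α) - φ (2 ^ j * α)) := by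
            refine Finset.sum_le_sum fun j _ => ?_
            split_ifs <;> simp
        _ = _ := sum_ofReal_increments hmono hα _
        _ ≤ _ := by
          have h0 : (0 : ℝ) ≤ 2 ^ (n + 1) * α := by positivity
          have := hmono h0 (h0.trans h) h
          exact ENNReal.ofReal_le_ofReal (by linarith [hnn α hα.le])
    · rw [Finset.sum_range_succ, if_neg h, add_zero]
      exact ih

theorem ofReal_le_add_tsum_increments {φ : ℝ → ℝ} (hmono : MonotoneOn φ (Set.Ici 0))
    (hnn : ∀ t, 0 ≤ t → 0 ≤ φ t) {β v : ℝ} (hβ : 0 < β) (hv : 0 ≤ v) :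
    ENNReal.ofReal (φ v) ≤ ENNReal.ofReal (φ β) + ∑' j : ℕ, (if 2 ^ j * β < v then
      ENNReal.ofReal (φ (2 ^ (j + 1) * β) - φ (2 ^ j * β)) else 0) := by
  rcases le_or_gt v β with h | h
  · exact le_add_right (ENNReal.ofReal_le_ofReal (hmono hv hβ.le h))
  obtain ⟨N, h1, h2⟩ := exists_dyadic_interval hβ h
  simp only [dyadic_lt_iff hβ h1 h2]
  have h3 : β ≤ 2 ^ (N + 1) * β := by linarith
  rw [tsum_ite_lt, sum_ofReal_increments hmono hβ,
    ← ENNReal.ofReal_add (hnn β hβ.le) (sub_nonneg.2 (hmono hβ.le (hβ.le.trans h3) h3))]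
  refine ENNReal.ofReal_le_ofReal ?_
  linarith [hmono hv (hv.trans h2) h2]

theorem orliczExtend_ofReal {d : ℕ} (Ψ : EuclideanSpace ℝ (Fin d) → ℝ → ℝ)
    (x : EuclideanSpace ℝ (Fin d)) {v : ℝ} (hv : 0 ≤ v) :
    orliczExtend Ψ x (ENNReal.ofReal v) = ENNReal.ofReal (Ψ x v) := by
  rw [orliczExtend, if_neg ENNReal.ofReal_ne_top, ENNReal.toReal_ofReal hv]

theorem orliczExtend_top {d : ℕ} (Ψ : EuclideanSpace ℝ (Fin d) → ℝ → ℝ)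
    (x : EuclideanSpace ℝ (Fin d)) : orliczExtend Ψ x ∞ = ∞ := if_pos rfl

theorem ENNReal.eq_top_or_eq_ofReal (τ : ℝ≥0∞) : τ = ∞ ∨ ∃ v : ℝ, 0 ≤ v ∧ τ = ENNReal.ofReal v := by
  rcases eq_or_ne τ ∞ with h | h
  · exact Or.inl h
  · exact Or.inr ⟨τ.toReal, ENNReal.toReal_nonneg, (ENNReal.ofReal_toReal h).symm⟩

theorem IsUniformlyDoublingOrlicz.nonneg {d : ℕ} {Ψ : EuclideanSpace ℝ (Fin d) → ℝ → ℝ}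
    (hΨ : IsUniformlyDoublingOrlicz Ψ) (x : EuclideanSpace ℝ (Fin d)) {t : ℝ} (ht : 0 ≤ t) :
    0 ≤ Ψ x t := by
  rcases ht.eq_or_lt with rfl | h
  · exact (hΨ.zero x).ge
  · exact (hΨ.pos x t h).le

theorem orliczExtend_two_pow_mul_le {d : ℕ} {Ψ : EuclideanSpace ℝ (Fin d) → ℝ → ℝ} {C₀ : ℝ}
    (hC₀ : 0 < C₀) (hdbl : ∀ x t, 0 ≤ t → Ψ x (2 * t) ≤ C₀ * Ψ x t)
    (x : EuclideanSpace ℝ (Fin d)) (n : ℕ) (τ : ℝ≥0∞) :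
    orliczExtend Ψ x (2 ^ n * τ) ≤ ENNReal.ofReal (C₀ ^ n) * orliczExtend Ψ x τ := by
  induction n with
  | zero => simp
  | succ n ih =>
    have h : ∀ σ, orliczExtend Ψ x (2 * σ) ≤ ENNReal.ofReal C₀ * orliczExtend Ψ x σ := by
      intro σ
      rcases ENNReal.eq_top_or_eq_ofReal σ with rfl | ⟨v, hv, rfl⟩
      · rw [orliczExtend_top, ENNReal.mul_top (show ENNReal.ofReal C₀ ≠ 0 by simpa using hC₀)]
        exact le_top
      · rw [show (2 : ℝ≥0∞) = ENNReal.ofReal 2 by simp, ← ENNReal.ofReal_mul (by norm_num),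
          orliczExtend_ofReal Ψ x hv, orliczExtend_ofReal Ψ x (by positivity),
          ← ENNReal.ofReal_mul hC₀.le]
        exact ENNReal.ofReal_le_ofReal (hdbl x v hv)
    calc orliczExtend Ψ x (2 ^ (n + 1) * τ) = orliczExtend Ψ x (2 * (2 ^ n * τ)) := by
          rw [pow_succ', mul_assoc]
      _ ≤ ENNReal.ofReal C₀ * (ENNReal.ofReal (C₀ ^ n) * orliczExtend Ψ x τ) :=
          (h _).trans (by gcongr)
      _ = _ := by rw [← mul_assoc, ← ENNReal.ofReal_mul hC₀.le, pow_succ']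

theorem orliczExtend_le_mul {d : ℕ} {Ψ : EuclideanSpace ℝ (Fin d) → ℝ → ℝ}
    (hΨ : IsUniformlyDoublingOrlicz Ψ) {C : ℝ} (hC : 0 < C) {x y : EuclideanSpace ℝ (Fin d)}
    (h : ∀ t : ℝ, 0 < t → Ψ x t ≤ C * Ψ y t) (τ : ℝ≥0∞) :
    orliczExtend Ψ x τ ≤ ENNReal.ofReal C * orliczExtend Ψ y τ := by
  rcases ENNReal.eq_top_or_eq_ofReal τ with rfl | ⟨v, hv, rfl⟩
  · rw [orliczExtend_top Ψ y, ENNReal.mul_top (by simpa using hC)]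
    exact le_top
  · rw [orliczExtend_ofReal Ψ x hv, orliczExtend_ofReal Ψ y hv, ← ENNReal.ofReal_mul hC.le]
    refine ENNReal.ofReal_le_ofReal ?_
    rcases hv.eq_or_lt with rfl | h0
    · simp [hΨ.zero]
    · exact h v h0

theorem tsum_increments_le_orliczExtend {d : ℕ} {Ψ : EuclideanSpace ℝ (Fin d) → ℝ → ℝ}
    (hΨ : IsUniformlyDoublingOrlicz Ψ) (x : EuclideanSpace ℝ (Fin d)) {α : ℝ} (hα : 0 < α)
    (τ : ℝ≥0∞) :
    ∑' j : ℕ, (if ENNReal.ofReal (2 ^ (j + 1) * α) ≤ τ then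
      ENNReal.ofReal (Ψ x (2 ^ (j + 1) * α) - Ψ x (2 ^ j * α)) else 0) ≤ orliczExtend Ψ x τ := by
  rcases ENNReal.eq_top_or_eq_ofReal τ with rfl | ⟨v, hv, rfl⟩
  · rw [orliczExtend_top]
    exact le_top
  · rw [orliczExtend_ofReal Ψ x hv]
    simp only [ENNReal.ofReal_le_ofReal_iff hv]
    exact tsum_increments_le (hΨ.monotoneOn x) (fun t ht => hΨ.nonneg x ht) hα

theorem orliczExtend_le_add_tsum_increments {d : ℕ} {Ψ : EuclideanSpace ℝ (Fin d) → ℝ → ℝ}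
    (hΨ : IsUniformlyDoublingOrlicz Ψ) (x : EuclideanSpace ℝ (Fin d)) {β : ℝ} (hβ : 0 < β)
    (τ : ℝ≥0∞) :
    orliczExtend Ψ x τ ≤ ENNReal.ofReal (Ψ x β) +
      ∑' j : ℕ, (if ENNReal.ofReal (2 ^ j * β) < τ then
        ENNReal.ofReal (Ψ x (2 ^ (j + 1) * β) - Ψ x (2 ^ j * β)) else 0) := by
  have key : ∀ v : ℝ, 0 ≤ v → ENNReal.ofReal v ≤ τ → ENNReal.ofReal (Ψ x v) ≤
      ENNReal.ofReal (Ψ x β) + ∑' j : ℕ, (if ENNReal.ofReal (2 ^ j * β) < τ then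
        ENNReal.ofReal (Ψ x (2 ^ (j + 1) * β) - Ψ x (2 ^ j * β)) else 0) := by
    intro v hv hvτ
    refine (ofReal_le_add_tsum_increments (hΨ.monotoneOn x) (fun t ht => hΨ.nonneg x ht) hβ
      hv).trans ?_
    gcongr with j
    by_cases h : 2 ^ j * β < v
    · have hj : ENNReal.ofReal (2 ^ j * β) < ENNReal.ofReal v :=
        (ENNReal.ofReal_lt_ofReal_iff (lt_trans (by positivity) h)).2 h
      rw [if_pos h, if_pos (hj.trans_le hvτ)]
    · rw [if_neg h]
      exact zero_le
  rcases ENNReal.eq_top_or_eq_ofReal τ with rfl | ⟨v, hv, rfl⟩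
  · rw [orliczExtend_top]
    have ht : Filter.Tendsto (fun v => ENNReal.ofReal (Ψ x v)) Filter.atTop (nhds ∞) :=
      ENNReal.tendsto_ofReal_atTop.comp (hΨ.tendsto_atTop x)
    refine le_of_tendsto ht ?_
    filter_upwards [Filter.eventually_ge_atTop 0] with v hv
    exact key v hv le_top
  · rw [orliczExtend_ofReal Ψ x hv]
    exact key v hv le_rfl

/-- Integration of a weight that is a superposition of level indicators. -/
theorem lintegral_enorm_mul_tsum_ite {E : Type*} [MeasurableSpace E] {μ : Measure E} {f : E → ℂ}
    (hf : AEMeasurable f μ) (c : ℕ → ℝ≥0∞) (s : ℕ → ℝ) :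
    ∫⁻ x, ‖f x‖ₑ * ∑' j, (if s j < ‖f x‖ then c j else 0) ∂μ =
      ∑' j, c j * ∫⁻ x in {x | s j < ‖f x‖}, ‖f x‖ₑ ∂μ := by
  have hS : ∀ j, NullMeasurableSet {x | s j < ‖f x‖} μ := fun j =>
    nullMeasurableSet_lt aemeasurable_const hf.norm
  have heq : ∀ x, ‖f x‖ₑ * ∑' j, (if s j < ‖f x‖ then c j else 0) =
      ∑' j, c j * Set.indicator {x | s j < ‖f x‖} (fun x => ‖f x‖ₑ) x := by
    intro x
    rw [← ENNReal.tsum_mul_left]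
    refine tsum_congr fun j => ?_
    by_cases h : s j < ‖f x‖
    · rw [if_pos h, Set.indicator_of_mem (show x ∈ {x | s j < ‖f x‖} from h), mul_comm]
    · rw [if_neg h, Set.indicator_of_notMem (show x ∉ {x | s j < ‖f x‖} from h)]
      simp
  have hm : ∀ j, AEMeasurable (Set.indicator {x | s j < ‖f x‖} fun x => ‖f x‖ₑ) μ := fun j =>
    hf.enorm.indicator₀ (hS j)
  simp only [heq]
  rw [lintegral_tsum fun j => (hm j).const_mul _]
  refine tsum_congr fun j => ?_
  rw [lintegral_const_mul'' _ (hm j), lintegral_indicator₀ (hS j)]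

/-- Integration over a set of a superposition of indicators. -/
theorem setLIntegral_tsum_ite {E : Type*} [MeasurableSpace E] {μ : Measure E} (B : Set E)
    (c : ℕ → ℝ≥0∞) {P : ℕ → E → Prop} [∀ j x, Decidable (P j x)]
    (hP : ∀ j, MeasurableSet {x | P j x}) :
    ∫⁻ x in B, ∑' j, (if P j x then c j else 0) ∂μ = ∑' j, c j * μ (B ∩ {x | P j x}) := by
  rw [lintegral_tsum fun j => (Measurable.ite (hP j) measurable_const measurable_const).aemeasurable]
  refine tsum_congr fun j => ?_
  have : (fun x => if P j x then c j else 0) = Set.indicator {x | P j x} fun _ => c j := by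
    ext x
    by_cases h : P j x
    · rw [if_pos h, Set.indicator_of_mem (show x ∈ {x | P j x} from h)]
    · rw [if_neg h, Set.indicator_of_notMem (show x ∉ {x | P j x} from h)]
  rw [this, lintegral_indicator_const (hP j), Measure.restrict_apply (hP j), Set.inter_comm]

theorem setLIntegral_orliczExtend_hardyLittlewood_le {d : ℕ} (hd : 0 < d)
    {Ψ : EuclideanSpace ℝ (Fin d) → ℝ → ℝ} (hΨ : IsUniformlyDoublingOrlicz Ψ) {C₀ : ℝ}
    (hC₀ : 0 < C₀) (hdbl : ∀ x t, 0 ≤ t → Ψ x (2 * t) ≤ C₀ * Ψ x t)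
    {f : EuclideanSpace ℝ (Fin d) → ℂ} (hf : AEMeasurable f volume)
    (hfi : ∫⁻ x, ‖f x‖ₑ ≠ ∞) (x₀ : EuclideanSpace ℝ (Fin d)) (B : Set (EuclideanSpace ℝ (Fin d)))
    {α : ℝ} (hα : 0 < α) :
    ∫⁻ x in B, orliczExtend Ψ x₀ (hardyLittlewood f x) ≤
      ENNReal.ofReal (Ψ x₀ (2 * α)) * volume B + ENNReal.ofReal (C₀ ^ 2) * 5 ^ d *
        ∫⁻ x, ‖f x‖ₑ * dyadicWeight (Ψ x₀) α ‖f x‖ := by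
  have hM := measurable_hardyLittlewood f
  calc _ ≤ ∫⁻ x in B, (ENNReal.ofReal (Ψ x₀ (2 * α)) +
        ∑' j : ℕ, (if ENNReal.ofReal (2 ^ j * (2 * α)) < hardyLittlewood f x then
          ENNReal.ofReal (Ψ x₀ (2 ^ (j + 1) * (2 * α)) - Ψ x₀ (2 ^ j * (2 * α))) else 0)) :=
        lintegral_mono fun x => orliczExtend_le_add_tsum_increments hΨ x₀ (by positivity) _
    _ = ENNReal.ofReal (Ψ x₀ (2 * α)) * volume B + ∑' j : ℕ,
          ENNReal.ofReal (Ψ x₀ (2 ^ (j + 1) * (2 * α)) - Ψ x₀ (2 ^ j * (2 * α))) *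
          volume (B ∩ {x | ENNReal.ofReal (2 ^ j * (2 * α)) < hardyLittlewood f x}) := by
        rw [lintegral_add_left measurable_const, setLIntegral_const,
          setLIntegral_tsum_ite B _ fun j => measurableSet_lt measurable_const hM]
    _ ≤ _ := by
        refine add_le_add le_rfl ?_
        simp only [dyadicWeight]
        rw [lintegral_enorm_mul_tsum_ite hf _ fun j => 2 ^ j * α, ← ENNReal.tsum_mul_left]
        refine ENNReal.tsum_le_tsum fun j => ?_
        set s := 2 ^ j * α with hs
        have hs0 : 0 < s := by positivity
        have h1 : Ψ x₀ (2 ^ (j + 1) * (2 * α)) - Ψ x₀ (2 ^ j * (2 * α)) ≤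
            C₀ ^ 2 * (Ψ x₀ s / s) * s := by
          have e1 := hdbl x₀ (2 * s) (by positivity)
          have e2 := mul_le_mul_of_nonneg_left (hdbl x₀ s hs0.le) hC₀.le
          have e3 := hΨ.nonneg x₀ (show (0 : ℝ) ≤ 2 ^ j * (2 * α) by positivity)
          rw [show (2 : ℝ) ^ (j + 1) * (2 * α) = 2 * (2 * s) by rw [hs]; ring, mul_assoc,
            div_mul_cancel₀ _ hs0.ne']
          nlinarith
        have h2 := mul_volume_hardyLittlewood_gt_le hd hf hfi hs0
        have hb : 0 ≤ Ψ x₀ s / s := div_nonneg (hΨ.nonneg x₀ hs0.le) hs0.le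
        rw [show (2 : ℝ) ^ j * (2 * α) = 2 * s by rw [hs]; ring] at h1 ⊢
        calc _ ≤ ENNReal.ofReal (C₀ ^ 2 * (Ψ x₀ s / s) * s) *
              volume {x | ENNReal.ofReal (2 * s) < hardyLittlewood f x} := by
              gcongr
              exact Set.inter_subset_right
          _ = ENNReal.ofReal (C₀ ^ 2) * ENNReal.ofReal (Ψ x₀ s / s) * (ENNReal.ofReal s *
              volume {x | ENNReal.ofReal (2 * s) < hardyLittlewood f x}) := by
              rw [ENNReal.ofReal_mul (by positivity), ENNReal.ofReal_mul (by positivity)]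
              ring
          _ ≤ ENNReal.ofReal (C₀ ^ 2) * ENNReal.ofReal (Ψ x₀ s / s) *
              (5 ^ d * ∫⁻ x in {x | s < ‖f x‖}, ‖f x‖ₑ) := by gcongr
          _ = _ := by ring

/-- Integrability of the maximal function composed with `Ψ` controls the dyadic weight. -/
theorem lintegral_mul_dyadicWeight_lt_top {d : ℕ}
    {Ψ : EuclideanSpace ℝ (Fin d) → ℝ → ℝ} (hΨ : IsUniformlyDoublingOrlicz Ψ)
    {f : EuclideanSpace ℝ (Fin d) → ℂ} (hf : AEMeasurable f volume)
    (hfi : ∫⁻ x, ‖f x‖ₑ ≠ ∞) {x₀ : EuclideanSpace ℝ (Fin d)} {r : ℝ} (hr : 0 < r)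
    (hsupp : ∀ x, x ∉ Metric.closedBall x₀ r → f x = 0)
    (hM : ∫⁻ x in Metric.closedBall x₀ r, orliczExtend Ψ x₀ (hardyLittlewood f x) < ∞)
    {α : ℝ} (hα : 0 < α) :
    ∫⁻ x, ‖f x‖ₑ * dyadicWeight (Ψ x₀) α ‖f x‖ < ∞ := by
  obtain ⟨C₀, hC₀, hdbl⟩ := hΨ.doubling
  set B := Metric.closedBall x₀ r with hB
  set F := ∫⁻ x, ‖f x‖ₑ with hF
  have hB0 : volume B ≠ 0 := (Metric.measure_closedBall_pos volume _ hr).ne'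
  obtain ⟨n₀, hn₀⟩ : ∃ n₀ : ℕ, ∀ j, n₀ ≤ j →
      F ≤ ENNReal.ofReal (2 ^ (j + 1) * α) * volume B := by
    obtain ⟨n, hn⟩ := pow_unbounded_of_one_lt ((F / volume B).toReal / α)
      (by norm_num : (1 : ℝ) < 2)
    refine ⟨n, fun j hj => ?_⟩
    have hq : F / volume B ≠ ∞ := ENNReal.div_ne_top hfi hB0
    rw [← ENNReal.div_le_iff_le_mul (Or.inl hB0) (Or.inl measure_closedBall_lt_top.ne),
      ← ENNReal.ofReal_toReal hq]
    refine ENNReal.ofReal_le_ofReal ?_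
    rw [div_lt_iff₀ hα] at hn
    refine hn.le.trans ?_
    gcongr
    · norm_num
    · omega
  set D : ℕ → ℝ := fun j => Ψ x₀ (2 ^ (j + 1) * α) - Ψ x₀ (2 ^ j * α) with hD
  have hMm := measurable_hardyLittlewood f
  have h2d : (4 : ℝ≥0∞) ^ d = 2 ^ (2 * d) := by rw [pow_mul]; norm_num
  have main : ∑' j, ENNReal.ofReal (D j) *
      volume (B ∩ {y | ENNReal.ofReal (2 ^ (j + 1) * α) ≤ 4 ^ d * hardyLittlewood f y}) < ∞ := by
    rw [← setLIntegral_tsum_ite B _ fun j => measurableSet_le measurable_const (hMm.const_mul _)]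
    calc _ ≤ ∫⁻ x in B, ENNReal.ofReal (C₀ ^ (2 * d)) *
          orliczExtend Ψ x₀ (hardyLittlewood f x) := by
          refine lintegral_mono fun x => ?_
          refine (tsum_increments_le_orliczExtend hΨ x₀ hα _).trans ?_
          rw [h2d]
          exact orliczExtend_two_pow_mul_le hC₀ hdbl x₀ (2 * d) _
      _ < ∞ := by
          rw [lintegral_const_mul' _ _ ENNReal.ofReal_ne_top]
          exact ENNReal.mul_lt_top ENNReal.ofReal_lt_top hM
  have level : ∀ j, ENNReal.ofReal (D j / (2 ^ j * α)) *
      ∫⁻ x in {x | 2 ^ (j + 1) * α < ‖f x‖}, ‖f x‖ₑ ≤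
      2 * 16 ^ d * (ENNReal.ofReal (D j) *
        volume (B ∩ {y | ENNReal.ofReal (2 ^ (j + 1) * α) ≤ 4 ^ d * hardyLittlewood f y})) +
      (if j < n₀ then ENNReal.ofReal (D j / (2 ^ j * α)) * F else 0) := by
    intro j
    by_cases hj : j < n₀
    · rw [if_pos hj]
      refine le_add_left ?_
      gcongr
      exact setLIntegral_le_lintegral _ _
    · rw [if_neg hj, add_zero]
      have hs : (0 : ℝ) < 2 ^ (j + 1) * α := by positivity
      have h := setLIntegral_gt_le_mul_volume hf hfi hr hsupp hs (hn₀ j (not_lt.1 hj))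
      have he : ENNReal.ofReal (D j / (2 ^ j * α)) * ENNReal.ofReal (2 ^ (j + 1) * α) =
          2 * ENNReal.ofReal (D j) := by
        rw [← ENNReal.ofReal_mul' hs.le, show (2 : ℝ≥0∞) = ENNReal.ofReal 2 by simp,
          ← ENNReal.ofReal_mul (by norm_num)]
        congr 1
        rw [pow_succ]
        field_simp
      calc _ ≤ _ := mul_le_mul_right h _
        _ = 16 ^ d * (ENNReal.ofReal (D j / (2 ^ j * α)) * ENNReal.ofReal (2 ^ (j + 1) * α)) *
          volume (B ∩ {y | ENNReal.ofReal (2 ^ (j + 1) * α) ≤ 4 ^ d * hardyLittlewood f y}) := by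
            ring
        _ = _ := by rw [he]; ring
  calc _ ≤ ∫⁻ x, (ENNReal.ofReal (2 * Ψ x₀ α / α) * ‖f x‖ₑ + ‖f x‖ₑ *
        ∑' j : ℕ, (if 2 ^ (j + 1) * α < ‖f x‖ then ENNReal.ofReal (D j / (2 ^ j * α)) else 0)) := by
        refine lintegral_mono fun x => ?_
        rw [mul_comm (ENNReal.ofReal _), ← mul_add]
        gcongr
        exact dyadicWeight_le_tsum_increments (hΨ.monotoneOn x₀) (hΨ.pos x₀) hα _
    _ = ENNReal.ofReal (2 * Ψ x₀ α / α) * F + ∑' j : ℕ, ENNReal.ofReal (D j / (2 ^ j * α)) *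
          ∫⁻ x in {x | 2 ^ (j + 1) * α < ‖f x‖}, ‖f x‖ₑ := by
        rw [lintegral_add_left' (hf.enorm.const_mul _), lintegral_const_mul'' _ hf.enorm,
          lintegral_enorm_mul_tsum_ite hf _ fun j => 2 ^ (j + 1) * α]
    _ ≤ ENNReal.ofReal (2 * Ψ x₀ α / α) * F + (2 * 16 ^ d * ∑' j, ENNReal.ofReal (D j) *
        volume (B ∩ {y | ENNReal.ofReal (2 ^ (j + 1) * α) ≤ 4 ^ d * hardyLittlewood f y}) +
        ∑ j ∈ Finset.range n₀, ENNReal.ofReal (D j / (2 ^ j * α)) * F) := by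
        rw [← tsum_ite_lt, ← ENNReal.tsum_mul_left, ← ENNReal.tsum_add]
        gcongr with j
        exact level j
    _ < ∞ := by
        refine ENNReal.add_lt_top.2 ⟨ENNReal.mul_lt_top ENNReal.ofReal_lt_top hfi.lt_top,
          ENNReal.add_lt_top.2 ⟨ENNReal.mul_lt_top ?_ main, ENNReal.sum_lt_top.2 fun j _ =>
            ENNReal.mul_lt_top ENNReal.ofReal_lt_top hfi.lt_top⟩⟩
        finiteness

/-- A function supported in a ball is integrable if its maximal function is finite somewhere
on the ball. -/
theorem lintegral_ne_top_of_hardyLittlewood_ne_top {d : ℕ}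
    {f : EuclideanSpace ℝ (Fin d) → ℂ} {x₀ x : EuclideanSpace ℝ (Fin d)} {r : ℝ} (hr : 0 < r)
    (hsupp : ∀ x, x ∉ Metric.closedBall x₀ r → f x = 0) (hx : x ∈ Metric.closedBall x₀ r)
    (hM : hardyLittlewood f x ≠ ∞) : ∫⁻ x, ‖f x‖ₑ ≠ ∞ := by
  have h1 : (volume (Metric.ball x (3 * r)))⁻¹ * ∫⁻ y in Metric.ball x (3 * r), ‖f y‖ₑ ≠ ∞ :=
    ne_top_of_le_ne_top hM (le_iSup₂_of_le (3 * r) (by positivity) le_rfl)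
  have h2 : ∫⁻ y, ‖f y‖ₑ = ∫⁻ y in Metric.ball x (3 * r), ‖f y‖ₑ := by
    rw [← lintegral_indicator measurableSet_ball]
    refine lintegral_congr fun y => ?_
    by_cases hy : y ∈ Metric.ball x (3 * r)
    · rw [Set.indicator_of_mem hy]
    · rw [Set.indicator_of_notMem hy, hsupp y, enorm_zero]
      intro hyB
      rw [Metric.mem_closedBall] at hx hyB
      rw [Metric.mem_ball] at hy
      linarith [dist_triangle_right y x x₀]
  rw [h2]
  intro h3
  rw [h3, ENNReal.mul_top (ENNReal.inv_ne_zero.2 measure_ball_lt_top.ne)] at h1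
  exact h1 rfl

theorem mainTheorem3 {d : ℕ} (hd : 0 < d)
    (ψ : EuclideanSpace ℝ (Fin d) → ℝ → ℝ)
    (hψ_int : ∀ x t, 0 ≤ t → IntervalIntegrable (ψ x) volume 0 t)
    (hΨ_meas : ∀ t, 0 ≤ t → AEMeasurable (fun x => primitiveFn ψ x t) volume)
    (hΨ_orlicz : IsUniformlyDoublingOrlicz (primitiveFn ψ))
    (hΨ_comp : IsLocallyComparable (primitiveFn ψ))
    (hψ_div : ∀ x, ∀ α₀ β₀ : ℝ, 0 < α₀ → α₀ < β₀ →
      IntervalIntegrable (fun s => ψ x s / s) volume α₀ β₀)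
    (x₀ : EuclideanSpace ℝ (Fin d)) (r : ℝ) (hr : 0 < r)
    (f : EuclideanSpace ℝ (Fin d) → ℂ) (hf : AEMeasurable f volume)
    (hf_supp : tsupport f ⊆ Metric.closedBall x₀ r) :
    MemMusielakOrlicz (primitiveFn ψ) (Metric.closedBall x₀ r) (hardyLittlewood f) ↔
      ∀ α₀ : ℝ, 0 < α₀ →
        ∫⁻ x in {x | α₀ < ‖f x‖},
          ‖f x‖ₑ * ENNReal.ofReal (∫ s in α₀..‖f x‖, ψ x s / s) < ∞ := by
  set Ψ := primitiveFn ψ with hΨdef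
  set B := Metric.closedBall x₀ r with hB
  have hBm : MeasurableSet B := Metric.isClosed_closedBall.measurableSet
  have hBt : volume B ≠ ∞ := measure_closedBall_lt_top.ne
  have hx₀ : x₀ ∈ B := Metric.mem_closedBall_self hr.le
  have hsupp : ∀ x, x ∉ B → f x = 0 := fun x hx =>
    image_eq_zero_of_notMem_tsupport fun h => hx (hf_supp h)
  have hmemB : ∀ {α : ℝ} {x}, 0 < α → α < ‖f x‖ → x ∈ B := by
    intro α x hα hx
    by_contra h
    rw [hsupp x h, norm_zero] at hx
    linarith
  obtain ⟨C₀, hC₀, hdbl⟩ := hΨ_orlicz.doubling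
  obtain ⟨C, hC, hcomp⟩ := hΨ_comp B (isCompact_closedBall x₀ r)
  have hS : ∀ α : ℝ, NullMeasurableSet {x | α < ‖f x‖} volume := fun α =>
    nullMeasurableSet_lt aemeasurable_const hf.norm
  constructor
  · rintro ⟨-, hfin⟩ α hα
    have hM : ∫⁻ x in B, orliczExtend Ψ x₀ (hardyLittlewood f x) < ∞ := by
      calc _ ≤ ∫⁻ x in B, ENNReal.ofReal C * orliczExtend Ψ x (hardyLittlewood f x) :=
            setLIntegral_mono' hBm fun x hx =>
              orliczExtend_le_mul hΨ_orlicz hC (hcomp x₀ hx₀ x hx) _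
        _ < ∞ := by
            rw [lintegral_const_mul' _ _ ENNReal.ofReal_ne_top]
            exact ENNReal.mul_lt_top ENNReal.ofReal_lt_top hfin
    have hfi : ∫⁻ x, ‖f x‖ₑ ≠ ∞ := by
      by_contra hcon
      have htop : ∀ x ∈ B, ∞ ≤ orliczExtend Ψ x (hardyLittlewood f x) := by
        intro x hx
        by_cases h : hardyLittlewood f x = ∞
        · rw [h, orliczExtend_top]
        · exact absurd hcon (lintegral_ne_top_of_hardyLittlewood_ne_top hr hsupp hx h)
      have h1 := setLIntegral_mono' (μ := volume) hBm htop
      rw [setLIntegral_const, ENNReal.top_mul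
        (Metric.measure_closedBall_pos volume _ hr).ne'] at h1
      exact absurd hfin (not_lt.2 h1)
    have hJ := lintegral_mul_dyadicWeight_lt_top hΨ_orlicz hf hfi hr hsupp hM hα
    rw [← lintegral_indicator₀ (hS α)]
    calc _ ≤ ∫⁻ x, (ENNReal.ofReal (1 + C₀) * ENNReal.ofReal C) *
          (‖f x‖ₑ * dyadicWeight (Ψ x₀) α ‖f x‖) := by
          refine lintegral_mono fun y => ?_
          by_cases hy' : α < ‖f y‖
          swap
          · rw [Set.indicator_of_notMem (show y ∉ {x | α < ‖f x‖} from hy')]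
            exact zero_le
          rw [Set.indicator_of_mem (show y ∈ {x | α < ‖f x‖} from hy')]
          calc _ ≤ ‖f y‖ₑ * (ENNReal.ofReal (1 + C₀) * dyadicWeight (Ψ y) α ‖f y‖) := by
                gcongr
                exact ofReal_integral_div_le_dyadicWeight rfl (hψ_int y) (hΨ_orlicz.monotoneOn y)
                  (hψ_div y) (hΨ_orlicz.pos y) hC₀ (hdbl y) hα hy'
            _ ≤ ‖f y‖ₑ * (ENNReal.ofReal (1 + C₀) *
                (ENNReal.ofReal C * dyadicWeight (Ψ x₀) α ‖f y‖)) := by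
                gcongr
                exact dyadicWeight_le_mul hC.le (hcomp y (hmemB hα hy') x₀ hx₀) hα _
            _ = _ := by ring
      _ < ∞ := by
          rw [lintegral_const_mul' _ _ (by finiteness)]
          exact ENNReal.mul_lt_top (by finiteness) hJ
  · intro hcond
    refine ⟨(measurable_hardyLittlewood f).aemeasurable, ?_⟩
    have hcond1 := hcond 1 one_pos
    rw [← lintegral_indicator₀ (hS 1)] at hcond1
    have hfi : ∫⁻ x, ‖f x‖ₑ ≠ ∞ := by
      obtain ⟨β, hβ1, hβ⟩ := ((Filter.eventually_gt_atTop (1 : ℝ)).and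
        ((hΨ_orlicz.tendsto_atTop x₀).eventually_ge_atTop (C * (C * Ψ x₀ 1 + 1)))).exists
      have hβ0 : 0 < β := by linarith
      refine ne_of_lt ?_
      calc ∫⁻ x, ‖f x‖ₑ ≤ ∫⁻ x, (Set.indicator B (fun _ => ENNReal.ofReal β) x +
            ENNReal.ofReal β * Set.indicator {x | 1 < ‖f x‖} (fun x => ‖f x‖ₑ *
              ENNReal.ofReal (∫ s in (1 : ℝ)..‖f x‖, ψ x s / s)) x) := by
            refine lintegral_mono fun x => ?_
            rcases le_or_gt ‖f x‖ β with h | h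
            · by_cases hxB : x ∈ B
              · refine le_add_right ?_
                rw [Set.indicator_of_mem hxB, ← ofReal_norm]
                exact ENNReal.ofReal_le_ofReal h
              · simp [hsupp x hxB]
            · refine le_add_left ?_
              have h1 : 1 < ‖f x‖ := hβ1.trans h
              have hxB := hmemB one_pos h1
              rw [Set.indicator_of_mem (show x ∈ {x | 1 < ‖f x‖} from h1)]
              have hgap : 1 ≤ Ψ x β - Ψ x 1 := by
                have e1 := hcomp x₀ hx₀ x hxB β hβ0
                have e2 := hcomp x hxB x₀ hx₀ 1 one_pos
                have e3 := le_of_mul_le_mul_left (hβ.trans e1) hC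
                linarith
              have e4 := le_integral_div (hψ_int x) (hΨ_orlicz.monotoneOn x) (hψ_div x)
                one_pos hβ1.le
              have e5 := integral_div_mono (hψ_int x) (hΨ_orlicz.monotoneOn x) (hψ_div x)
                one_pos hβ1.le h.le
              have e6 : 1 / β ≤ ∫ s in (1 : ℝ)..‖f x‖, ψ x s / s :=
                ((div_le_div_of_nonneg_right hgap hβ0.le).trans e4).trans e5
              have e7 : (1 : ℝ≥0∞) ≤ ENNReal.ofReal β *
                  ENNReal.ofReal (∫ s in (1 : ℝ)..‖f x‖, ψ x s / s) := by
                rw [← ENNReal.ofReal_mul hβ0.le, ← ENNReal.ofReal_one]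
                refine ENNReal.ofReal_le_ofReal ?_
                rwa [div_le_iff₀' hβ0] at e6
              calc ‖f x‖ₑ = ‖f x‖ₑ * 1 := (mul_one _).symm
                _ ≤ ‖f x‖ₑ * (ENNReal.ofReal β *
                  ENNReal.ofReal (∫ s in (1 : ℝ)..‖f x‖, ψ x s / s)) := by gcongr
                _ = _ := by ring
        _ < ∞ := by
            rw [lintegral_add_left (measurable_const.indicator hBm),
              lintegral_indicator_const hBm, lintegral_const_mul' _ _ ENNReal.ofReal_ne_top]
            exact ENNReal.add_lt_top.2 ⟨ENNReal.mul_lt_top ENNReal.ofReal_lt_top hBt.lt_top,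
              ENNReal.mul_lt_top ENNReal.ofReal_lt_top hcond1⟩
    have hJ : ∫⁻ x, ‖f x‖ₑ * dyadicWeight (Ψ x₀) 1 ‖f x‖ < ∞ := by
      calc _ ≤ ∫⁻ x, (ENNReal.ofReal C * ENNReal.ofReal (2 * (C * Ψ x₀ 1) / 1) * ‖f x‖ₑ +
            ENNReal.ofReal C * 2 * Set.indicator {x | 1 < ‖f x‖} (fun x => ‖f x‖ₑ *
              ENNReal.ofReal (∫ s in (1 : ℝ)..‖f x‖, ψ x s / s)) x) := by
            refine lintegral_mono fun x => ?_
            rcases le_or_gt ‖f x‖ 1 with h | h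
            · simp [dyadicWeight_of_le one_pos h]
            · have hxB := hmemB one_pos h
              rw [Set.indicator_of_mem (show x ∈ {x | 1 < ‖f x‖} from h)]
              calc _ ≤ ‖f x‖ₑ * (ENNReal.ofReal C * dyadicWeight (Ψ x) 1 ‖f x‖) := by
                    gcongr
                    exact dyadicWeight_le_mul hC.le (hcomp x₀ hx₀ x hxB) one_pos _
                _ ≤ ‖f x‖ₑ * (ENNReal.ofReal C * (ENNReal.ofReal (2 * Ψ x 1 / 1) +
                    2 * ENNReal.ofReal (∫ s in (1 : ℝ)..‖f x‖, ψ x s / s))) := by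
                    gcongr
                    exact dyadicWeight_le_integral_div rfl (hψ_int x) (hΨ_orlicz.monotoneOn x)
                      (hψ_div x) (hΨ_orlicz.pos x) one_pos h
                _ ≤ ‖f x‖ₑ * (ENNReal.ofReal C * (ENNReal.ofReal (2 * (C * Ψ x₀ 1) / 1) +
                    2 * ENNReal.ofReal (∫ s in (1 : ℝ)..‖f x‖, ψ x s / s))) := by
                    gcongr
                    exact hcomp x hxB x₀ hx₀ 1 one_pos
                _ = _ := by ring
        _ < ∞ := by
            rw [lintegral_add_left' (hf.enorm.const_mul _), lintegral_const_mul'' _ hf.enorm,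
              lintegral_const_mul' _ _ (by finiteness)]
            exact ENNReal.add_lt_top.2 ⟨ENNReal.mul_lt_top (by finiteness) hfi.lt_top,
              ENNReal.mul_lt_top (by finiteness) hcond1⟩
    calc _ ≤ ∫⁻ x in B, ENNReal.ofReal C * orliczExtend Ψ x₀ (hardyLittlewood f x) :=
          setLIntegral_mono' hBm fun x hx =>
            orliczExtend_le_mul hΨ_orlicz hC (hcomp x hx x₀ hx₀) _
      _ < ∞ := by
          rw [lintegral_const_mul' _ _ ENNReal.ofReal_ne_top]
          refine ENNReal.mul_lt_top ENNReal.ofReal_lt_top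
            ((setLIntegral_orliczExtend_hardyLittlewood_le hd hΨ_orlicz hC₀ hdbl hf hfi x₀ B
              one_pos).trans_lt ?_)
          exact ENNReal.add_lt_top.2 ⟨ENNReal.mul_lt_top ENNReal.ofReal_lt_top hBt.lt_top,
            ENNReal.mul_lt_top (by finiteness) hJ⟩
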